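/- Let $\mathsf{E}_8\subset\mathbb{R}^8\subset\mathbb{C}^8$ be the set of the 240 shortest vectors of the $E_8$ lattice, that is, $$\mathsf{E}_8=\{\pm e_i\pm e_j \mid 1\le i\ne j\le 8\}\ \cup\ \{(\pm\tfrac12,\dots,\pm\tfrac12) \mid \text{an even number of minus signs}\}.$$ Let $\mathcal{I}(\mathsf{E}_8)\subseteq\mathbb{C}[Y_1,\dots,Y_8]$ be the ideal of all polynomials vanishing on $\mathsf{E}_8$, and let $\mathsf{Nm}=\sum_{i=1}^8Y_i^2-2$. A polynomial is called trivial if it is a multiple of $\mathsf{Nm}$. From each of the 120 antipodal pairs $\{a,-a\}$ in $\mathsf{E}_8$ choose one representative $a$, and choose any seven linearly independent vectors $b_{a,1},\dots,b_{a,7}\in\mathbb{R}^8$ orthogonal to $a$. Let $\mathcal{G}$ be the set consisting of $\mathsf{Nm}$ and the $120\cdot 7$ sliced zonal polynomials $$(a\cdot Y-1)\,(a\cdot Y)\,(a\cdot Y+1)\,(b_{a,i}\cdot Y)$$ of degree four, where $a\cdot Y=\sum_j a_jY_j$. Then, for every such choice, the ideal $\mathsf{I}=\langle\mathcal{G}\rangle$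 of $\mathbb{C}[Y_1,\dots,Y_8]$ and the ideal $\mathcal{I}(\mathsf{E}_8)$ have the following properties: (i) the set of common zeros of $\mathsf{I}$ in $\mathbb{C}^8$ is exactly $\mathsf{E}_8$; (ii) each zero $p$ of $\mathsf{I}$ is simple, that is, the Zariski tangent space $\{v\in\mathbb{C}^8 \mid \sum_j v_j\,\frac{\partial F}{\partial Y_j}(p)=0 \text{ for all } F\in\mathsf{I}\}$ is zero; moreover, $\mathsf{I}$ is a radical ideal, and $\mathsf{I}=\mathcal{I}(\mathsf{E}_8)$; (iii) the smallest degree of a non-trivial polynomial in $\mathcal{I}(\mathsf{E}_8)$ is four; (iv) $\mathcal{I}(\mathsf{E}_8)$ is generated by a set of polynomials all having degree four or less. -/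

import Mathlib

namespace E8Ideal

open MvPolynomial

/-- The 240 roots of `E₈`, the shortest vectors of the lattice `E₈`: the vectors `± eᵢ ± eⱼ` with
`i ≠ j`, and the vectors `(± 1/2, …, ± 1/2)` with an even number of minus signs. -/
def roots : Set (Fin 8 → ℝ) :=
  {v | ∃ i j : Fin 8, i ≠ j ∧ ∃ s t : ℝ, (s = 1 ∨ s = -1) ∧ (t = 1 ∨ t = -1) ∧
      v = Pi.single i s + Pi.single j t} ∪
  {v | (∀ i, v i = 1 / 2 ∨ v i = -(1 / 2)) ∧ Even (Set.ncard {i | v i = -(1 / 2)})}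

/-- A real vector regarded as a point of `ℂᵐ`. -/
def toComplex {m : ℕ} (v : Fin m → ℝ) : Fin m → ℂ := fun i => (v i : ℂ)

/-- The set of roots as a subset of `ℂ⁸`. -/
def rootsC : Set (Fin 8 → ℂ) := toComplex '' roots

/-- The linear form `a · Y = a₁ Y₁ + ⋯ + aₘ Yₘ` with real coefficients, in `ℂ[Y₁, …, Yₘ]`. -/
noncomputable def linForm {m : ℕ} (a : Fin m → ℝ) : MvPolynomial (Fin m) ℂ :=
  ∑ i, C (a i : ℂ) * X i

/-- The equation `Y₁² + ⋯ + Y₈² - 2` of the sphere of radius `√2`, which contains the roots. Its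
multiples are the trivial polynomials. -/
noncomputable def Nm : MvPolynomial (Fin 8) ℂ := (∑ i, X i ^ 2) - C 2

/-- The sliced zonal polynomial based at `a` with slicing vector `b`. Two roots have inner product
`2, 1, 0, -1` or `-2`; the extreme values `2` and `-2` are left out. -/
noncomputable def slicedZonal (a b : Fin 8 → ℝ) : MvPolynomial (Fin 8) ℂ :=
  (linForm a - C 1) * linForm a * (linForm a + C 1) * linForm b

/-- `P` contains exactly one root from each antipodal pair `{a, -a}` of roots. -/
def IsPairRepresentatives (P : Set (Fin 8 → ℝ)) : Prop :=
  P ⊆ roots ∧ ∀ a ∈ roots, Xor (a ∈ P) (-a ∈ P)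

/-- For each `a ∈ P`, the vectors `b a 0, …, b a 6` are linearly independent (over `ℝ`) and
orthogonal to `a`. -/
def IsSlicingChoice (P : Set (Fin 8 → ℝ)) (b : (Fin 8 → ℝ) → Fin 7 → (Fin 8 → ℝ)) : Prop :=
  ∀ a ∈ P, LinearIndependent ℝ (b a) ∧ ∀ i, a ⬝ᵥ b a i = 0

/-- The generating set: `Nm` together with the seven sliced zonal polynomials for each antipodal
pair. -/
def generators (P : Set (Fin 8 → ℝ)) (b : (Fin 8 → ℝ) → Fin 7 → (Fin 8 → ℝ)) :
    Set (MvPolynomial (Fin 8) ℂ) :=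
  {Nm} ∪ {F | ∃ a ∈ P, ∃ i : Fin 7, F = slicedZonal a (b a i)}

/-- The Zariski tangent space of the ideal `I` at `p`: the common kernel of the differentials at
`p` of all polynomials in `I`. -/
noncomputable def tangentSpace {m : ℕ} (I : Ideal (MvPolynomial (Fin m) ℂ)) (p : Fin m → ℂ) :
    Submodule ℂ (Fin m → ℂ) where
  carrier := {v | ∀ F ∈ I, ∑ i, v i * eval p (pderiv i F) = 0}
  zero_mem' := by
    intro F _
    simp
  add_mem' := by
    intro v w hv hw F hF
    simp only [Pi.add_apply, add_mul, Finset.sum_add_distrib, hv F hF, hw F hF, add_zero]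
  smul_mem' := by
    intro c v hv F hF
    simp only [Pi.smul_apply, smul_eq_mul, mul_assoc, ← Finset.mul_sum, hv F hF, mul_zero]

/-- `p` is a simple zero of `I`: it is a zero, and the Zariski tangent space there is
zero-dimensional. -/
def IsSimpleZero {m : ℕ} (I : Ideal (MvPolynomial (Fin m) ℂ)) (p : Fin m → ℂ) : Prop :=
  p ∈ zeroLocus ℂ I ∧ tangentSpace I p = ⊥

end E8Ideal

/-!
Write `x = a · Y` for a root `a`, and let `J` be any ideal that contains `Nm` and all
`(x - 1) x (x + 1) (b · Y)` with `b` orthogonal to `a`. Taking `b = 2 eᵢ - aᵢ a`, multiplying by `Yᵢ`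
and summing over `i` turns the last factor into `2 (Y · Y) - x²`, so that modulo `Nm` the ideal
contains the equation `x (x² - 1) (x² - 4)` in `x` alone (`quintic_mem`). This polynomial is
squarefree, which gives everything about multiplicities at once:

* its derivative does not vanish at its roots, so tangent vectors are orthogonal to all roots `a`, and
  hence zero (`tangentSpace_eq_bot`);
* in the quotient by `J` the differentials of all `a · Y` vanish, so the quotient is unramified over
  `ℂ` and therefore reduced (`isRadical_of_quintic_mem`).

A zero `p` of `J` outside the roots has `a · p ∈ {0, 1, -1}` for all roots `a`, since otherwise it is
orthogonal to `a^⊥` and hence equal to `± a`; an elementary argument shows that this is impossible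
(`mem_rootsC_of_dotProduct`). If `J` vanishes on the roots, the Nullstellensatz now yields that `J` is
the vanishing ideal (`eq_vanishingIdeal`). This applies to the ideal generated by `generators P b`,
because sliced zonal polynomials are linear in the slicing vector and odd in `a`, and to the ideal
generated by all polynomials of degree at most four that vanish on the roots.

For the lower bound on the degree, a polynomial of degree at most three is, modulo `Nm`, the sum of a
quadratic and a cubic form, and `v ↦ -v` separates the two. A quadratic form that vanishes on the roots
`± eᵢ ± eⱼ` is zero (`bilinear_apply_self_eq_zero`). For a cubic form, polarized to a symmetric
trilinear `T`, third differences along cubes of half-integral roots give `T(e_a, e_b, e_c) = 0` for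
distinct indices (`trilinear_basisVec_eq_zero`), the roots `± eᵢ ± eⱼ` express the coefficients of
`xᵢ xⱼ²` by those of `xᵢ³`, and the half-integral roots then kill the latter
(`trilinear_apply_self_eq_zero`).
-/

namespace E8Ideal

open MvPolynomial

/-! ### The roots: inner products and cardinality -/

/-- The vector with entries `-1/2` on `S` and `1/2` off `S`. -/
noncomputable def halfVec (S : Finset (Fin 8)) : Fin 8 → ℝ :=
  fun i => if i ∈ S then -(1 / 2) else 1 / 2

theorem halfVec_injective : Function.Injective halfVec := by
  intro S T h
  ext i
  have hi := congrFun h i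
  simp only [halfVec] at hi
  split_ifs at hi with h1 h2 h2 <;> first | (exfalso; linarith) | simp [h1, h2]

theorem eq_neg_half_set_halfVec (S : Finset (Fin 8)) :
    {i | halfVec S i = -(1 / 2)} = (S : Set (Fin 8)) := by
  ext i
  simp only [halfVec, Set.mem_ofPred_eq, Finset.mem_coe]
  split_ifs with h
  · simp [h]
  · simp only [h, iff_false]; norm_num

theorem halfRoots_eq_image :
    {v : Fin 8 → ℝ | (∀ i, v i = 1 / 2 ∨ v i = -(1 / 2)) ∧ Even (Set.ncard {i | v i = -(1 / 2)})} =
      halfVec '' {S | Even S.card} := by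
  ext v
  constructor
  · rintro ⟨hv, he⟩
    classical
    refine ⟨Finset.univ.filter fun i => v i = -(1 / 2), ?_, ?_⟩
    · rwa [Set.mem_ofPred_eq, ← Set.ncard_coe_finset, Finset.coe_filter_univ]
    · funext i
      rcases hv i with h | h
      · have : ¬ ((1 : ℝ) / 2 = -(1 / 2)) := by norm_num
        simp only [halfVec, Finset.mem_filter_univ, h, this, if_false]
      · simp only [halfVec, Finset.mem_filter_univ, h, if_true]
  · rintro ⟨S, hS, rfl⟩
    refine ⟨fun i => ?_, ?_⟩
    · simp only [halfVec]; split_ifs <;> simp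
    · rw [eq_neg_half_set_halfVec, Set.ncard_coe_finset]; exact hS

theorem mem_roots_iff {v : Fin 8 → ℝ} :
    v ∈ roots ↔ (∃ i j : Fin 8, i ≠ j ∧ ∃ s t : ℝ, (s = 1 ∨ s = -1) ∧ (t = 1 ∨ t = -1) ∧
      v = Pi.single i s + Pi.single j t) ∨ ∃ S : Finset (Fin 8), Even S.card ∧ halfVec S = v := by
  rw [roots, halfRoots_eq_image]
  rfl

theorem single_add_single_mem_roots {i j : Fin 8} (h : i ≠ j) {s t : ℝ} (hs : s = 1 ∨ s = -1)
    (ht : t = 1 ∨ t = -1) : Pi.single i s + Pi.single j t ∈ roots :=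
  mem_roots_iff.2 (Or.inl ⟨i, j, h, s, t, hs, ht, rfl⟩)

theorem halfVec_mem_roots {S : Finset (Fin 8)} (h : Even S.card) : halfVec S ∈ roots :=
  mem_roots_iff.2 (Or.inr ⟨S, h, rfl⟩)

theorem neg_halfVec (S : Finset (Fin 8)) : -halfVec S = halfVec Sᶜ := by
  funext i
  by_cases h : i ∈ S <;> simp [halfVec, h]

theorem neg_mem_roots {v : Fin 8 → ℝ} (hv : v ∈ roots) : -v ∈ roots := by
  rcases mem_roots_iff.1 hv with ⟨i, j, h, s, t, hs, ht, rfl⟩ | ⟨S, hS, rfl⟩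
  · rw [neg_add, ← Pi.single_neg, ← Pi.single_neg]
    refine single_add_single_mem_roots h ?_ ?_
    · rcases hs with rfl | rfl <;> simp
    · rcases ht with rfl | rfl <;> simp
  · rw [neg_halfVec]
    refine halfVec_mem_roots ?_
    rw [Finset.card_compl, Fintype.card_fin]
    exact (Nat.even_sub (by simpa using S.card_le_univ)).2 (iff_of_true (by decide) hS)

theorem halfVec_dotProduct_halfVec (S T : Finset (Fin 8)) :
    halfVec S ⬝ᵥ halfVec T = 2 - (S.card : ℝ) / 2 - (T.card : ℝ) / 2 + ((S ∩ T).card : ℝ) := by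
  have h : ∀ i, halfVec S i * halfVec T i = 1 / 4 - (1 / 2) * (if i ∈ S then 1 else 0)
      - (1 / 2) * (if i ∈ T then 1 else 0) + (if i ∈ S ∩ T then 1 else 0) := by
    intro i
    by_cases h1 : i ∈ S <;> by_cases h2 : i ∈ T <;> simp [halfVec, h1, h2] <;> norm_num
  simp only [dotProduct, h, Finset.sum_add_distrib, Finset.sum_sub_distrib, ← Finset.mul_sum,
    Finset.sum_boole, Finset.filter_univ_mem, Finset.sum_const, Finset.card_univ, Fintype.card_fin]
  norm_num
  ring

theorem dotProduct_self_of_mem_roots {a : Fin 8 → ℝ} (ha : a ∈ roots) : a ⬝ᵥ a = 2 := by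
  rcases mem_roots_iff.1 ha with ⟨i, j, h, s, t, hs, ht, rfl⟩ | ⟨S, hS, rfl⟩
  · rw [add_dotProduct, single_dotProduct, single_dotProduct]
    simp only [Pi.add_apply, Pi.single_eq_same, Pi.single_eq_of_ne h, Pi.single_eq_of_ne h.symm]
    rcases hs with rfl | rfl <;> rcases ht with rfl | rfl <;> norm_num
  · rw [halfVec_dotProduct_halfVec, Finset.inter_self]
    ring

theorem ne_zero_of_mem_roots {a : Fin 8 → ℝ} (ha : a ∈ roots) : a ≠ 0 := by
  rintro rfl
  simpa using dotProduct_self_of_mem_roots ha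

theorem exists_intCast_eq_dotProduct {a r : Fin 8 → ℝ} (ha : a ∈ roots) (hr : r ∈ roots) :
    ∃ n : ℤ, (n : ℝ) = a ⬝ᵥ r := by
  -- Against `± eᵢ ± eⱼ`, the claim is that all `± rᵢ ± rⱼ` are integers.
  have key : ∀ (i j : Fin 8) (s t : ℝ), (s = 1 ∨ s = -1) → (t = 1 ∨ t = -1) → ∀ r ∈ roots,
      ∃ n : ℤ, (n : ℝ) = (Pi.single i s + Pi.single j t) ⬝ᵥ r := by
    intro i j s t hs ht r hr
    rw [add_dotProduct, single_dotProduct, single_dotProduct]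
    obtain ⟨s, rfl⟩ : ∃ m : ℤ, (m : ℝ) = s := by
      rcases hs with rfl | rfl
      exacts [⟨1, by simp⟩, ⟨-1, by simp⟩]
    obtain ⟨t, rfl⟩ : ∃ m : ℤ, (m : ℝ) = t := by
      rcases ht with rfl | rfl
      exacts [⟨1, by simp⟩, ⟨-1, by simp⟩]
    rcases mem_roots_iff.1 hr with ⟨k, l, -, s', t', hs', ht', rfl⟩ | ⟨S, -, rfl⟩
    · have hint : ∀ m : Fin 8, ∃ n : ℤ, (n : ℝ) = (Pi.single k s' + Pi.single l t' : Fin 8 → ℝ) m := by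
        intro m
        simp only [Pi.add_apply, Pi.single_apply]
        rcases hs' with rfl | rfl <;> rcases ht' with rfl | rfl <;> split_ifs
        all_goals
          solve
          | refine ⟨0, ?_⟩; norm_num | refine ⟨1, ?_⟩; norm_num | refine ⟨-1, ?_⟩; norm_num
          | refine ⟨2, ?_⟩; norm_num | refine ⟨-2, ?_⟩; norm_num
      obtain ⟨m, hm⟩ := hint i
      obtain ⟨n, hn⟩ := hint j
      exact ⟨s * m + t * n, by rw [← hm, ← hn]; push_cast; ring⟩
    · have hs' : s = 1 ∨ s = -1 := by exact_mod_cast hs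
      have ht' : t = 1 ∨ t = -1 := by exact_mod_cast ht
      simp only [halfVec]
      rcases hs' with rfl | rfl <;> rcases ht' with rfl | rfl <;> split_ifs
      all_goals
        solve
        | refine ⟨0, ?_⟩; norm_num | refine ⟨1, ?_⟩; norm_num | refine ⟨-1, ?_⟩; norm_num
  rcases mem_roots_iff.1 ha with ⟨i, j, h, s, t, hs, ht, rfl⟩ | ⟨S, hS, rfl⟩
  · exact key i j s t hs ht r hr
  · rcases mem_roots_iff.1 hr with ⟨i, j, h, s, t, hs, ht, rfl⟩ | ⟨T, hT, rfl⟩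
    · rw [dotProduct_comm]
      exact key i j s t hs ht _ ha
    · obtain ⟨m, hm⟩ := hS
      obtain ⟨n, hn⟩ := hT
      refine ⟨2 - m - n + (S ∩ T).card, ?_⟩
      rw [halfVec_dotProduct_halfVec, hm, hn]
      push_cast
      ring

/-- The inner product of two roots is an integer, and `2` or `-2` only in the case of equality
in the Cauchy–Schwarz inequality. -/
theorem eq_or_eq_neg_or_dotProduct {a r : Fin 8 → ℝ} (ha : a ∈ roots) (hr : r ∈ roots) :
    r = a ∨ r = -a ∨ a ⬝ᵥ r = 0 ∨ a ⬝ᵥ r = 1 ∨ a ⬝ᵥ r = -1 := by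
  obtain ⟨n, hn⟩ := exists_intCast_eq_dotProduct ha hr
  have haa := dotProduct_self_of_mem_roots ha
  have hrr := dotProduct_self_of_mem_roots hr
  have hsub : (r - a) ⬝ᵥ (r - a) = 4 - 2 * (n : ℝ) := by
    rw [sub_dotProduct, dotProduct_sub, dotProduct_sub, haa, hrr, dotProduct_comm r a, ← hn]
    ring
  have hadd : (r + a) ⬝ᵥ (r + a) = 4 + 2 * (n : ℝ) := by
    rw [add_dotProduct, dotProduct_add, dotProduct_add, haa, hrr, dotProduct_comm r a, ← hn]
    ring
  have h0 : ∀ v : Fin 8 → ℝ, 0 ≤ v ⬝ᵥ v := fun v => Finset.sum_nonneg fun i _ => mul_self_nonneg _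
  have h1 : n ≤ 2 := by
    have := h0 (r - a)
    rw [hsub] at this
    exact_mod_cast (by linarith : (n : ℝ) ≤ 2)
  have h2 : -2 ≤ n := by
    have := h0 (r + a)
    rw [hadd] at this
    exact_mod_cast (by linarith : (-2 : ℝ) ≤ n)
  rw [← hn]
  interval_cases n
  · refine Or.inr (Or.inl (eq_neg_of_add_eq_zero_left (dotProduct_self_eq_zero.1 ?_)))
    rw [hadd]; norm_num
  · simp
  · simp
  · simp
  · refine Or.inl (sub_eq_zero.1 (dotProduct_self_eq_zero.1 ?_))
    rw [hsub]; norm_num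

theorem ncard_halfRoots :
    (halfVec '' {S : Finset (Fin 8) | Even S.card}).ncard = 128 := by
  rw [Set.ncard_image_of_injective _ halfVec_injective]
  have : {S : Finset (Fin 8) | Even S.card} =
      ((Finset.univ.filter fun S : Finset (Fin 8) => Even S.card : Finset (Finset (Fin 8))) :
        Set (Finset (Fin 8))) := by
    ext S; simp
  rw [this, Set.ncard_coe_finset]
  decide +kernel

theorem ncard_integralRoots :
    {v : Fin 8 → ℝ | ∃ i j : Fin 8, i ≠ j ∧ ∃ s t : ℝ, (s = 1 ∨ s = -1) ∧ (t = 1 ∨ t = -1) ∧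
      v = Pi.single i s + Pi.single j t}.ncard = 112 := by
  -- Each such vector is counted once by the pairs `i < j` together with two signs.
  let A : Finset ((Fin 8 × Fin 8) × ℝ × ℝ) :=
    (Finset.univ.filter fun p : Fin 8 × Fin 8 => p.1 < p.2) ×ˢ ({1, -1} ×ˢ {1, -1})
  let f : (Fin 8 × Fin 8) × ℝ × ℝ → Fin 8 → ℝ :=
    fun x => Pi.single x.1.1 x.2.1 + Pi.single x.1.2 x.2.2
  have hmem : ∀ x : (Fin 8 × Fin 8) × ℝ × ℝ, x ∈ A ↔
      x.1.1 < x.1.2 ∧ (x.2.1 = 1 ∨ x.2.1 = -1) ∧ (x.2.2 = 1 ∨ x.2.2 = -1) := by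
    intro x; simp [A]
  have himage : {v : Fin 8 → ℝ | ∃ i j : Fin 8, i ≠ j ∧ ∃ s t : ℝ, (s = 1 ∨ s = -1) ∧
      (t = 1 ∨ t = -1) ∧ v = Pi.single i s + Pi.single j t} = f '' A := by
    ext v
    constructor
    · rintro ⟨i, j, hij, s, t, hs, ht, rfl⟩
      rcases lt_or_gt_of_ne hij with h | h
      · exact ⟨((i, j), (s, t)), (hmem _).2 ⟨h, hs, ht⟩, rfl⟩
      · exact ⟨((j, i), (t, s)), (hmem _).2 ⟨h, ht, hs⟩, add_comm _ _⟩
    · rintro ⟨⟨⟨i, j⟩, ⟨s, t⟩⟩, hx, rfl⟩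
      obtain ⟨h, hs, ht⟩ := (hmem _).1 hx
      exact ⟨i, j, h.ne, s, t, hs, ht, rfl⟩
  have hinj : Set.InjOn f A := by
    rintro ⟨⟨i, j⟩, ⟨s, t⟩⟩ hx ⟨⟨i', j'⟩, ⟨s', t'⟩⟩ hy h
    obtain ⟨hij, hs, ht⟩ := (hmem _).1 hx
    obtain ⟨hij', hs', ht'⟩ := (hmem _).1 hy
    have e := fun k => congrFun h k
    simp only [f, Pi.add_apply, Pi.single_apply] at e hij hs ht hij' hs' ht'
    have e1 := e i
    have e2 := e j
    have e3 := e i'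
    have e4 := e j'
    clear e h hx hy hmem himage
    simp only [Prod.mk.injEq]
    grind
  rw [himage, hinj.ncard_image, Set.ncard_coe_finset, Finset.card_product,
    Finset.card_product, Finset.card_pair (by norm_num)]
  decide +kernel

theorem ncard_roots : roots.ncard = 240 := by
  have h1 := ncard_integralRoots
  have h2 := ncard_halfRoots
  rw [← halfRoots_eq_image] at h2
  rw [roots, Set.ncard_union_eq _ (Set.finite_of_ncard_ne_zero (by rw [h1]; norm_num))
    (Set.finite_of_ncard_ne_zero (by rw [h2]; norm_num)), h1, h2]
  rw [Set.disjoint_left]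
  rintro v ⟨i, j, hij, s, t, hs, ht, rfl⟩ ⟨h, -⟩
  have := h i
  simp only [Pi.add_apply, Pi.single_eq_same, Pi.single_eq_of_ne hij, add_zero] at this
  rcases hs with rfl | rfl <;> norm_num at this

/-! ### Linear forms and sliced zonal polynomials -/

theorem linForm_add {m : ℕ} (a b : Fin m → ℝ) : linForm (a + b) = linForm a + linForm b := by
  simp [linForm, add_mul, Finset.sum_add_distrib]

theorem linForm_smul {m : ℕ} (c : ℝ) (a : Fin m → ℝ) : linForm (c • a) = C (c : ℂ) * linForm a := by
  simp [linForm, Finset.mul_sum, mul_assoc]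

theorem linForm_neg {m : ℕ} (a : Fin m → ℝ) : linForm (-a) = -linForm a := by
  simp [linForm]

theorem linForm_zero {m : ℕ} : linForm (0 : Fin m → ℝ) = 0 := by
  simp [linForm]

theorem linForm_single {m : ℕ} (i : Fin m) (s : ℝ) : linForm (Pi.single i s) = C (s : ℂ) * X i := by
  rw [linForm, Finset.sum_eq_single i]
  · simp
  · intro j _ hj
    simp [Pi.single_eq_of_ne hj]
  · simp

theorem eval_linForm {m : ℕ} (a : Fin m → ℝ) (p : Fin m → ℂ) :
    eval p (linForm a) = toComplex a ⬝ᵥ p := by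
  simp [linForm, dotProduct, toComplex]

theorem pderiv_linForm {m : ℕ} (a : Fin m → ℝ) (i : Fin m) : pderiv i (linForm a) = C (a i : ℂ) := by
  classical
  simp [linForm, pderiv_X, Pi.single_apply]

theorem totalDegree_linForm_le {m : ℕ} (a : Fin m → ℝ) : (linForm a).totalDegree ≤ 1 := by
  refine totalDegree_finsetSum_le fun i _ => (totalDegree_mul _ _).trans ?_
  simp

theorem toComplex_dotProduct_toComplex {m : ℕ} (a b : Fin m → ℝ) :
    toComplex a ⬝ᵥ toComplex b = ((a ⬝ᵥ b : ℝ) : ℂ) := by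
  simp [dotProduct, toComplex]

theorem toComplex_single_add_single_dotProduct {m : ℕ} (i j : Fin m) (s t : ℝ) (p : Fin m → ℂ) :
    toComplex (Pi.single i s + Pi.single j t) ⬝ᵥ p = s * p i + t * p j := by
  rw [← eval_linForm, linForm_add, linForm_single, linForm_single]
  simp

theorem toComplex_neg {m : ℕ} (a : Fin m → ℝ) : toComplex (-a) = -toComplex a := by
  funext i; simp [toComplex]

theorem neg_mem_rootsC {p : Fin 8 → ℂ} (hp : p ∈ rootsC) : -p ∈ rootsC := by
  obtain ⟨a, ha, rfl⟩ := hp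
  exact ⟨-a, neg_mem_roots ha, toComplex_neg a⟩

theorem eval_Nm (p : Fin 8 → ℂ) : eval p Nm = (∑ i, p i ^ 2) - 2 := by
  simp [Nm]

theorem eval_slicedZonal (a b : Fin 8 → ℝ) (p : Fin 8 → ℂ) :
    eval p (slicedZonal a b) = (toComplex a ⬝ᵥ p - 1) * (toComplex a ⬝ᵥ p) *
      (toComplex a ⬝ᵥ p + 1) * (toComplex b ⬝ᵥ p) := by
  simp [slicedZonal, eval_linForm]

theorem totalDegree_slicedZonal_le (a b : Fin 8 → ℝ) : (slicedZonal a b).totalDegree ≤ 4 := by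
  have ha := totalDegree_linForm_le a
  have hb := totalDegree_linForm_le b
  have h1 : (linForm a - C 1).totalDegree ≤ 1 := by
    refine (totalDegree_sub _ _).trans (max_le ha ?_); simp
  have h2 : (linForm a + C 1).totalDegree ≤ 1 := by
    refine (totalDegree_add _ _).trans (max_le ha ?_); simp
  have e1 := totalDegree_mul ((linForm a - C 1) * linForm a * (linForm a + C 1)) (linForm b)
  have e2 := totalDegree_mul ((linForm a - C 1) * linForm a) (linForm a + C 1)
  have e3 := totalDegree_mul (linForm a - C 1) (linForm a)
  rw [slicedZonal]
  omega

theorem totalDegree_Nm_le : Nm.totalDegree ≤ 2 := by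
  refine (totalDegree_sub _ _).trans (max_le (totalDegree_finsetSum_le fun i _ => ?_) ?_)
  · simp
  · simp

theorem mem_vanishingIdeal_rootsC {F : MvPolynomial (Fin 8) ℂ} :
    F ∈ vanishingIdeal ℂ rootsC ↔ ∀ a ∈ roots, eval (toComplex a) F = 0 := by
  simp [rootsC, aeval_eq_eval]

theorem Nm_mem_vanishingIdeal : Nm ∈ vanishingIdeal ℂ rootsC := by
  refine mem_vanishingIdeal_rootsC.2 fun a ha => ?_
  have h := toComplex_dotProduct_toComplex a a
  rw [dotProduct_self_of_mem_roots ha] at h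
  simp only [dotProduct, ← pow_two] at h
  rw [eval_Nm, h]
  simp

theorem slicedZonal_mem_vanishingIdeal {a b : Fin 8 → ℝ} (ha : a ∈ roots) (hab : a ⬝ᵥ b = 0) :
    slicedZonal a b ∈ vanishingIdeal ℂ rootsC := by
  refine mem_vanishingIdeal_rootsC.2 fun r hr => ?_
  rw [eval_slicedZonal, toComplex_dotProduct_toComplex, toComplex_dotProduct_toComplex]
  rcases eq_or_eq_neg_or_dotProduct ha hr with rfl | rfl | h | h | h
  · simp [dotProduct_comm b, hab]
  · simp [dotProduct_comm b, hab]
  all_goals simp [h]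

/-! ### Points of the complex sphere with prescribed inner products -/

/-- If `p` is a multiple of the root `a`, then `p · p = 2` forces `p = ± a`. -/
theorem mem_rootsC_of_proportional {a : Fin 8 → ℝ} (ha : a ∈ roots) {p : Fin 8 → ℂ}
    (hp : ∑ i, p i ^ 2 = 2) {t : ℂ} (h : ∀ i, 2 * p i = t * a i) : p ∈ rootsC := by
  have haa := toComplex_dotProduct_toComplex a a
  rw [dotProduct_self_of_mem_roots ha] at haa
  have ht : t ^ 2 = 4 := by
    have h4 : 4 * ∑ i, p i ^ 2 = t ^ 2 * (toComplex a ⬝ᵥ toComplex a) := by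
      rw [dotProduct, Finset.mul_sum, Finset.mul_sum]
      refine Finset.sum_congr rfl fun i _ => ?_
      simp only [toComplex]
      linear_combination (2 * p i + t * a i) * h i
    rw [hp, haa] at h4
    push_cast at h4
    linear_combination -h4 / 2
  have ht' : t = 2 ∨ t = -2 := sq_eq_sq_iff_eq_or_eq_neg.1 (by rw [ht]; norm_num)
  rcases ht' with rfl | rfl
  · refine ⟨a, ha, funext fun i => ?_⟩
    rw [toComplex]
    linear_combination -h i / 2
  · refine ⟨-a, neg_mem_roots ha, funext fun i => ?_⟩
    rw [toComplex_neg, Pi.neg_apply, toComplex]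
    linear_combination -h i / 2

/-- A point on the sphere of radius `√2` cannot have inner products `0, 1, -1` only with the roots:
testing against `± eᵢ ± eⱼ` leaves the points `± eᵢ` and `(± 1/2, …, ± 1/2)`, the former are too
short, and the latter either are roots or have inner product `3/2` with a root. -/
theorem mem_rootsC_of_dotProduct {p : Fin 8 → ℂ} (hp : ∑ i, p i ^ 2 = 2)
    (h : ∀ a ∈ roots, toComplex a ⬝ᵥ p = 0 ∨ toComplex a ⬝ᵥ p = 1 ∨ toComplex a ⬝ᵥ p = -1) :
    p ∈ rootsC := by
  have hpair : ∀ i j, i ≠ j → ((p i = 0 ∨ p i = 1 ∨ p i = -1) ∧ (p j = 0 ∨ p j = 1 ∨ p j = -1) ∧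
      (p i = 0 ∨ p j = 0)) ∨ (p i = 1 / 2 ∨ p i = -(1 / 2)) := by
    intro i j hij
    have h1 := h _ (single_add_single_mem_roots hij (Or.inl rfl) (Or.inl rfl))
    have h2 := h _ (single_add_single_mem_roots hij (Or.inl rfl) (Or.inr rfl))
    simp only [toComplex_single_add_single_dotProduct, Complex.ofReal_one, Complex.ofReal_neg,
      one_mul, neg_mul] at h1 h2
    have ei : ∀ x y : ℂ, p i + p j = x → p i + -p j = y → p i = (x + y) / 2 := by
      intro x y hx hy; rw [← hx, ← hy]; ring
    have ej : ∀ x y : ℂ, p i + p j = x → p i + -p j = y → p j = (x - y) / 2 := by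
      intro x y hx hy; rw [← hx, ← hy]; ring
    rcases h1 with h1 | h1 | h1 <;> rcases h2 with h2 | h2 | h2 <;>
      rw [ei _ _ h1 h2, ej _ _ h1 h2] <;> norm_num
  have hne : ∀ i : Fin 8, ∃ j, i ≠ j := fun i => (exists_ne i).imp fun _ => Ne.symm
  have hhalf : ∀ i, p i = 1 / 2 ∨ p i = -(1 / 2) := by
    by_contra! hcon
    obtain ⟨i, hi1, hi2⟩ := hcon
    have hi : ∀ j, i ≠ j → (p i = 0 ∨ p i = 1 ∨ p i = -1) ∧ (p j = 0 ∨ p j = 1 ∨ p j = -1) ∧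
        (p i = 0 ∨ p j = 0) := fun j hij => (hpair i j hij).resolve_right (by tauto)
    have hint : ∀ j, p j = 0 ∨ p j = 1 ∨ p j = -1 := by
      intro j
      by_cases hij : i = j
      · obtain ⟨k, hk⟩ := hne i
        exact hij ▸ (hi k hk).1
      · exact (hi j hij).2.1
    have hhalf_ne : ∀ j, ¬ (p j = 1 / 2 ∨ p j = -(1 / 2)) := by
      intro j
      rcases hint j with e | e | e <;> rw [e] <;> norm_num
    by_cases hz : ∀ j, p j = 0
    · simp [hz] at hp
    · push Not at hz
      obtain ⟨k, hk⟩ := hz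
      have h0 : ∀ j, j ≠ k → p j = 0 := fun j hj =>
        ((hpair k j hj.symm).resolve_right (hhalf_ne k)).2.2.resolve_left hk
      rw [Finset.sum_eq_single k (fun j _ hj => by rw [h0 j hj]; simp) (by simp)] at hp
      rcases hint k with e | e | e <;> rw [e] at hp <;> norm_num at hp
  classical
  let S : Finset (Fin 8) := Finset.univ.filter fun i => p i = -(1 / 2)
  have hS : toComplex (halfVec S) = p := by
    funext i
    rcases hhalf i with e | e
    · have : ¬ ((1 : ℂ) / 2 = -(1 / 2)) := by norm_num
      simp only [toComplex, halfVec, S, Finset.mem_filter_univ, e, this, if_false]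
      push_cast; rfl
    · simp only [toComplex, halfVec, S, Finset.mem_filter_univ, e, if_true]
      push_cast; rfl
  rcases Nat.even_or_odd S.card with hev | hodd
  · exact ⟨_, halfVec_mem_roots hev, hS⟩
  · exfalso
    obtain ⟨k, hk⟩ := Finset.card_pos.1 hodd.pos
    have hcard := Finset.card_erase_add_one hk
    have hev : Even (S.erase k).card := by
      rw [← hcard] at hodd
      exact (Nat.not_odd_iff_even).1 fun ho => (Nat.not_even_iff_odd.2 hodd) ho.add_one
    have h3 : halfVec (S.erase k) ⬝ᵥ halfVec S = 3 / 2 := by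
      rw [halfVec_dotProduct_halfVec, Finset.inter_eq_left.2 (S.erase_subset k), ← hcard]
      push_cast
      ring
    have h4 := h _ (halfVec_mem_roots hev)
    rw [← hS, toComplex_dotProduct_toComplex, h3] at h4
    norm_num at h4

/-! ### Ideals containing all sliced zonal polynomials -/

/-- A root of the squarefree polynomial `t (t² - 1) (t² - 4)` is killed by every derivation. -/
theorem derivation_eq_zero_of_quintic {A M : Type*} [CommRing A] [Algebra ℂ A] [AddCommGroup M]
    [Module A M] [Module ℂ M] (D : Derivation ℂ A M) {x : A}
    (hx : x * (x ^ 2 - 1) * (x ^ 2 - 4) = 0) : D x = 0 := by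
  have h5 : x ^ 5 - 5 * x ^ 3 + 4 * x = 0 := by linear_combination hx
  have hD : (5 * x ^ 4 - 15 * x ^ 2 + 4) • D x = 0 := by
    have h := congrArg D h5
    rw [map_zero, map_add, map_sub, D.leibniz_pow, D.leibniz, D.leibniz, D.leibniz_pow] at h
    have e4 : D (4 : A) = 0 := by exact_mod_cast D.map_natCast 4
    have e5 : D (5 : A) = 0 := by exact_mod_cast D.map_natCast 5
    rw [e4, e5, smul_zero, smul_zero, add_zero, add_zero] at h
    rw [← h]
    simp only [← Nat.cast_smul_eq_nsmul A, smul_smul, ← sub_smul, ← add_smul]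
    congr 1
    push_cast
    ring
  obtain ⟨c, hc⟩ : ∃ c : A, c * 288 = 1 := by
    refine ⟨algebraMap ℂ A (1 / 288), ?_⟩
    rw [← map_ofNat (algebraMap ℂ A) 288, ← map_mul]
    norm_num
  -- The Bézout identity between the polynomial and its derivative.
  have hb : (1 : A) = c * (72 - 155 * x ^ 2 + 35 * x ^ 4) * (5 * x ^ 4 - 15 * x ^ 2 + 4) := by
    linear_combination -hc + c * (425 - 175 * x ^ 2) * x * h5
  rw [← one_smul A (D x), hb, mul_smul, hD, smul_zero]

section Ideal

variable {J : Ideal (MvPolynomial (Fin 8) ℂ)}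

/-- Modulo the sphere equation, the coordinate forms orthogonal to a root `a` can be summed up to
`4 - (a · Y)²`, so an ideal containing all sliced zonal polynomials contains an equation in `a · Y`
alone. -/
theorem quintic_mem (hNm : Nm ∈ J)
    (hJ : ∀ a ∈ roots, ∀ b, a ⬝ᵥ b = 0 → slicedZonal a b ∈ J) {a : Fin 8 → ℝ} (ha : a ∈ roots) :
    linForm a * (linForm a ^ 2 - 1) * (linForm a ^ 2 - 4) ∈ J := by
  have hsum : ∑ i, X i * slicedZonal a (Pi.single i 2 + (-a i) • a) ∈ J := by
    refine J.sum_mem fun i _ => J.mul_mem_left _ (hJ a ha _ ?_)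
    rw [dotProduct_add, dotProduct_smul, dotProduct_self_of_mem_roots ha, dotProduct_single]
    simp only [smul_eq_mul]
    ring
  have hexp : ∑ i, X i * slicedZonal a (Pi.single i 2 + (-a i) • a) =
      linForm a * (linForm a ^ 2 - 1) * (2 * ∑ i, X i ^ 2 - linForm a * linForm a) := by
    conv_rhs => rw [show linForm a * linForm a = (∑ i, C (a i : ℂ) * X i) * linForm a from rfl]
    rw [Finset.sum_mul, Finset.mul_sum, ← Finset.sum_sub_distrib, Finset.mul_sum]
    refine Finset.sum_congr rfl fun i _ => ?_
    rw [slicedZonal, linForm_add, linForm_smul, linForm_single]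
    simp only [Complex.ofReal_neg, map_neg, map_one, Complex.ofReal_ofNat, map_ofNat]
    ring
  rw [hexp] at hsum
  have h2 := J.sub_mem (J.mul_mem_left (linForm a * (linForm a ^ 2 - 1) * 2) hNm) hsum
  convert h2 using 1
  simp only [Nm, map_ofNat]
  ring

theorem X_eq_linForm_add_linForm {i j : Fin 8} :
    (X i : MvPolynomial (Fin 8) ℂ) = C (1 / 2) *
      (linForm (Pi.single i 1 + Pi.single j 1) + linForm (Pi.single i 1 + Pi.single j (-1))) := by
  have h : (C (1 / 2 : ℂ) * 2 : MvPolynomial (Fin 8) ℂ) = 1 := by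
    rw [← map_ofNat C 2, ← map_mul]; norm_num
  simp only [linForm_add, linForm_single, Complex.ofReal_neg, Complex.ofReal_one, map_neg, map_one]
  linear_combination -X i * h

/-- The quotient is unramified over `ℂ`: the differentials of the forms `a · Y` vanish, and these
span the differentials of the coordinates. -/
theorem isRadical_of_quintic_mem
    (hJ : ∀ a ∈ roots, linForm a * (linForm a ^ 2 - 1) * (linForm a ^ 2 - 4) ∈ J) :
    J.IsRadical := by
  rw [Ideal.isRadical_iff_quotient_reduced]
  let A := MvPolynomial (Fin 8) ℂ ⧸ J
  let D := KaehlerDifferential.D ℂ A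
  have hlin : ∀ a ∈ roots, D (Ideal.Quotient.mk J (linForm a)) = 0 := by
    intro a ha
    refine derivation_eq_zero_of_quintic D ?_
    have := Ideal.Quotient.eq_zero_iff_mem.2 (hJ a ha)
    simpa only [map_mul, map_sub, map_pow, map_one, map_ofNat] using this
  have hC : ∀ c : ℂ, D (Ideal.Quotient.mk J (C c)) = 0 := fun c => D.map_algebraMap c
  have hX : ∀ i, D (Ideal.Quotient.mk J (X i)) = 0 := by
    intro i
    obtain ⟨j, hj⟩ := exists_ne i
    rw [X_eq_linForm_add_linForm (j := j), map_mul, map_add, D.leibniz, map_add, hC,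
      hlin _ (single_add_single_mem_roots hj.symm (Or.inl rfl) (Or.inl rfl)),
      hlin _ (single_add_single_mem_roots hj.symm (Or.inl rfl) (Or.inr rfl))]
    simp
  have hD : ∀ F : MvPolynomial (Fin 8) ℂ, D (Ideal.Quotient.mk J F) = 0 := by
    intro F
    induction F using MvPolynomial.induction_on with
    | C c => exact hC c
    | add F G hF hG => rw [map_add, map_add, hF, hG, add_zero]
    | mul_X F i hF => rw [map_mul, D.leibniz, hF, hX, smul_zero, smul_zero, add_zero]
  have hsub : Subsingleton (Ω[A⁄ℂ]) := by
    have htop := KaehlerDifferential.span_range_derivation ℂ A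
    have hbot : Submodule.span A (Set.range D) = ⊥ := by
      rw [Submodule.span_eq_bot]
      rintro _ ⟨x, rfl⟩
      obtain ⟨F, rfl⟩ := Ideal.Quotient.mk_surjective x
      exact hD F
    exact (Submodule.subsingleton_iff A).1 (subsingleton_of_bot_eq_top (hbot.symm.trans htop))
  have : Algebra.FormallyUnramified ℂ A := ⟨hsub⟩
  exact Algebra.FormallyUnramified.isReduced_of_field ℂ A

theorem zeroLocus_eq_rootsC (hNm : Nm ∈ J)
    (hJ : ∀ a ∈ roots, ∀ b, a ⬝ᵥ b = 0 → slicedZonal a b ∈ J)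
    (hle : J ≤ vanishingIdeal ℂ rootsC) : zeroLocus ℂ J = rootsC := by
  refine Set.Subset.antisymm ?_ (le_zeroLocus_iff_le_vanishingIdeal.2 hle)
  intro p hp
  simp only [mem_zeroLocus_iff, aeval_eq_eval] at hp
  have h2 : ∑ i, p i ^ 2 = 2 := by
    have := hp _ hNm
    change eval p Nm = 0 at this
    rwa [eval_Nm, sub_eq_zero] at this
  by_contra hcon
  refine hcon (mem_rootsC_of_dotProduct h2 fun a ha => ?_)
  by_contra! ht
  refine hcon (mem_rootsC_of_proportional ha h2 (t := toComplex a ⬝ᵥ p) fun i => ?_)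
  have hz := hp _ (hJ a ha (Pi.single i 2 + (-a i) • a) (by
    rw [dotProduct_add, dotProduct_smul, dotProduct_self_of_mem_roots ha, dotProduct_single]
    simp only [smul_eq_mul]
    ring))
  change eval p _ = 0 at hz
  have h1 : toComplex a ⬝ᵥ p + 1 ≠ 0 := fun h => ht.2.2 (eq_neg_of_add_eq_zero_left h)
  rw [eval_slicedZonal, mul_eq_zero, mul_eq_zero, mul_eq_zero, sub_eq_zero] at hz
  have hb := hz.resolve_left (by tauto)
  rw [← eval_linForm, linForm_add, linForm_smul, linForm_single] at hb
  simp [eval_linForm] at hb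
  linear_combination hb

/-- The Nullstellensatz for the radical ideal `J`. -/
theorem eq_vanishingIdeal (hNm : Nm ∈ J)
    (hJ : ∀ a ∈ roots, ∀ b, a ⬝ᵥ b = 0 → slicedZonal a b ∈ J)
    (hle : J ≤ vanishingIdeal ℂ rootsC) : J = vanishingIdeal ℂ rootsC := by
  rw [← zeroLocus_eq_rootsC hNm hJ hle, vanishingIdeal_zeroLocus_eq_radical,
    (isRadical_of_quintic_mem fun a ha => quintic_mem hNm hJ ha).radical]

theorem tangentSpace_eq_bot {p : Fin 8 → ℂ} (hp : p ∈ zeroLocus ℂ J)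
    (hJ : ∀ a ∈ roots, linForm a * (linForm a ^ 2 - 1) * (linForm a ^ 2 - 4) ∈ J) :
    tangentSpace J p = ⊥ := by
  rw [eq_bot_iff]
  intro v hv
  have hlin : ∀ a ∈ roots, toComplex a ⬝ᵥ v = 0 := by
    intro a ha
    have h0 := hp _ (hJ a ha)
    have h1 := hv _ (hJ a ha)
    change eval p _ = 0 at h0
    have hpd : ∀ i, eval p (pderiv i (linForm a * (linForm a ^ 2 - 1) * (linForm a ^ 2 - 4))) =
        (5 * (toComplex a ⬝ᵥ p) ^ 4 - 15 * (toComplex a ⬝ᵥ p) ^ 2 + 4) * toComplex a i := by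
      intro i
      have h4 : pderiv i (4 : MvPolynomial (Fin 8) ℂ) = 0 := by
        exact_mod_cast (pderiv i).map_natCast 4
      simp only [Derivation.leibniz, Derivation.leibniz_pow, map_sub, h4, Derivation.map_one_eq_zero,
        pderiv_linForm, smul_eq_mul, nsmul_eq_mul, map_add, map_mul, map_pow, eval_linForm, eval_C,
        map_zero, map_natCast, map_one, map_ofNat]
      simp only [toComplex]
      push_cast
      ring
    simp only [hpd] at h1
    have h2 : (5 * (toComplex a ⬝ᵥ p) ^ 4 - 15 * (toComplex a ⬝ᵥ p) ^ 2 + 4) *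
        (toComplex a ⬝ᵥ v) = 0 := by
      rw [show toComplex a ⬝ᵥ v = ∑ i, toComplex a i * v i from rfl, Finset.mul_sum, ← h1]
      exact Finset.sum_congr rfl fun i _ => by ring
    simp only [map_mul, map_sub, map_pow, map_one, map_ofNat, eval_linForm] at h0
    -- The Bézout identity again: the derivative is nonzero at the roots of the polynomial.
    have hb : (288 : ℂ) = (72 - 155 * (toComplex a ⬝ᵥ p) ^ 2 + 35 * (toComplex a ⬝ᵥ p) ^ 4) *
        (5 * (toComplex a ⬝ᵥ p) ^ 4 - 15 * (toComplex a ⬝ᵥ p) ^ 2 + 4) := by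
      linear_combination (425 - 175 * (toComplex a ⬝ᵥ p) ^ 2) * (toComplex a ⬝ᵥ p) * h0
    refine (mul_eq_zero.1 h2).resolve_left fun h => ?_
    rw [h, mul_zero] at hb
    norm_num at hb
  refine (Submodule.mem_bot ℂ).2 (funext fun i => ?_)
  obtain ⟨j, hj⟩ := exists_ne i
  have h1 := hlin _ (single_add_single_mem_roots hj.symm (Or.inl rfl) (Or.inl rfl))
  have h2 := hlin _ (single_add_single_mem_roots hj.symm (Or.inl rfl) (Or.inr rfl))
  simp only [toComplex_single_add_single_dotProduct, Complex.ofReal_one, Complex.ofReal_neg] at h1 h2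
  rw [Pi.zero_apply]
  linear_combination (h1 + h2) / 2

end Ideal

/-! ### The ideal of the generators -/

section Generators

variable {P : Set (Fin 8 → ℝ)} {b : (Fin 8 → ℝ) → Fin 7 → (Fin 8 → ℝ)}

theorem slicedZonal_neg (a b : Fin 8 → ℝ) : slicedZonal (-a) b = -slicedZonal a b := by
  simp only [slicedZonal, linForm_neg]
  ring

/-- The sliced zonal polynomial is linear in the slicing vector, so a basis of the hyperplane
orthogonal to `a` yields all slicing vectors. -/
theorem slicedZonal_mem_of_linearIndependent {J : Ideal (MvPolynomial (Fin 8) ℂ)}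
    {a : Fin 8 → ℝ} (ha : a ≠ 0) {c : Fin 7 → Fin 8 → ℝ} (hc : LinearIndependent ℝ c)
    (hac : ∀ i, a ⬝ᵥ c i = 0) (hJ : ∀ i, slicedZonal a (c i) ∈ J) {d : Fin 8 → ℝ}
    (had : a ⬝ᵥ d = 0) : slicedZonal a d ∈ J := by
  let φ : Module.Dual ℝ (Fin 8 → ℝ) := dotProductBilin ℝ ℝ a
  have hφ : φ ≠ 0 := fun h => ha (dotProduct_self_eq_zero.1 (LinearMap.congr_fun h a))
  have hspan : Submodule.span ℝ (Set.range c) = LinearMap.ker φ := by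
    refine Submodule.eq_of_le_of_finrank_eq ?_ ?_
    · rw [Submodule.span_le]
      rintro _ ⟨i, rfl⟩
      exact hac i
    · have := Module.Dual.finrank_ker_add_one_of_ne_zero hφ
      rw [finrank_span_eq_card hc]
      simp only [Module.finrank_fin_fun] at this
      simp only [Fintype.card_fin]
      omega
  have hd : d ∈ Submodule.span ℝ (Set.range c) := by
    rw [hspan]
    exact had
  clear had
  induction hd using Submodule.span_induction with
  | mem x hx =>
    obtain ⟨i, rfl⟩ := hx
    exact hJ i
  | zero => simp [slicedZonal, linForm_zero]
  | add x y _ _ hx hy =>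
    rw [slicedZonal, linForm_add, mul_add]
    exact J.add_mem hx hy
  | smul t x _ hx =>
    rw [slicedZonal, linForm_smul, mul_left_comm]
    exact J.mul_mem_left _ hx

theorem slicedZonal_mem_span_generators (hP : IsPairRepresentatives P) (hb : IsSlicingChoice P b)
    {a d : Fin 8 → ℝ} (ha : a ∈ roots) (had : a ⬝ᵥ d = 0) :
    slicedZonal a d ∈ Ideal.span (generators P b) := by
  have key : ∀ a ∈ P, a ⬝ᵥ d = 0 → slicedZonal a d ∈ Ideal.span (generators P b) :=
    fun a ha had => slicedZonal_mem_of_linearIndependent (ne_zero_of_mem_roots (hP.1 ha))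
      (hb a ha).1 (hb a ha).2
      (fun i => Ideal.subset_span (Or.inr ⟨a, ha, i, rfl⟩)) had
  rcases (hP.2 a ha).or with h | h
  · exact key a h had
  · rw [← neg_neg a, slicedZonal_neg]
    exact neg_mem (key _ h (by rw [neg_dotProduct, had, neg_zero]))

theorem span_generators_le (hP : IsPairRepresentatives P) (hb : IsSlicingChoice P b) :
    Ideal.span (generators P b) ≤ vanishingIdeal ℂ rootsC := by
  rw [Ideal.span_le]
  rintro F (rfl | ⟨a, ha, i, rfl⟩)
  · exact Nm_mem_vanishingIdeal
  · exact slicedZonal_mem_vanishingIdeal (hP.1 ha) ((hb a ha).2 i)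

end Generators

/-- At `(2, 0, i, i, 0, 0, 0, 0)`, on the complex sphere, the sliced zonal polynomial of
`e₁ + e₂` sliced by `e₁ - e₂` takes the value `12`. -/
theorem exists_quartic_not_dvd : ∃ F ∈ vanishingIdeal ℂ rootsC, ¬ Nm ∣ F ∧ F.totalDegree ≤ 4 := by
  refine ⟨slicedZonal (Pi.single 0 1 + Pi.single 1 1) (Pi.single 0 1 + Pi.single 1 (-1)),
    slicedZonal_mem_vanishingIdeal
      (single_add_single_mem_roots (by decide) (Or.inl rfl) (Or.inl rfl)) ?_, ?_,
    totalDegree_slicedZonal_le _ _⟩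
  · simp
  · rintro ⟨G, hG⟩
    have h := congrArg (eval ![2, 0, Complex.I, Complex.I, 0, 0, 0, 0]) hG
    rw [map_mul, eval_Nm, eval_slicedZonal, toComplex_single_add_single_dotProduct,
      toComplex_single_add_single_dotProduct] at h
    simp [Fin.sum_univ_eight] at h
    norm_num at h

/-! ### Polarization of quadratic and cubic forms -/

section Forms

theorem exists_linearMap_eval_eq {n : ℕ} {G : MvPolynomial (Fin n) ℂ}
    (hG : G ∈ homogeneousSubmodule (Fin n) ℂ 1) :
    ∃ φ : (Fin n → ℂ) →ₗ[ℂ] ℂ, ∀ x, eval x G = φ x := by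
  rw [homogeneousSubmodule_one_eq_span_X] at hG
  induction hG using Submodule.span_induction with
  | mem G hG =>
    obtain ⟨i, rfl⟩ := hG
    exact ⟨LinearMap.proj i, fun x => by simp⟩
  | zero => exact ⟨0, fun x => by simp⟩
  | add G H _ _ hG hH =>
    obtain ⟨φ, hφ⟩ := hG
    obtain ⟨ψ, hψ⟩ := hH
    exact ⟨φ + ψ, fun x => by simp [hφ, hψ]⟩
  | smul c G _ hG =>
    obtain ⟨φ, hφ⟩ := hG
    exact ⟨c • φ, fun x => by simp [hφ]⟩

theorem exists_bilinear_eval_eq {n : ℕ} {G : MvPolynomial (Fin n) ℂ}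
    (hG : G ∈ homogeneousSubmodule (Fin n) ℂ 2) :
    ∃ B : (Fin n → ℂ) →ₗ[ℂ] (Fin n → ℂ) →ₗ[ℂ] ℂ, (∀ x y, B x y = B y x) ∧
      ∀ x, eval x G = B x x := by
  rw [← homogeneousSubmodule_one_pow, pow_two] at hG
  induction hG using Submodule.mul_induction_on' with
  | mem_mul_mem G hG H hH =>
    obtain ⟨φ, hφ⟩ := exists_linearMap_eval_eq hG
    obtain ⟨ψ, hψ⟩ := exists_linearMap_eval_eq hH
    refine ⟨(1 / 2 : ℂ) • (φ.smulRight ψ + ψ.smulRight φ), fun x y => ?_, fun x => ?_⟩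
    · simp; ring
    · simp [hφ, hψ]; ring
  | add G _ H _ hG hH =>
    obtain ⟨B, hB, hGB⟩ := hG
    obtain ⟨B', hB', hHB⟩ := hH
    exact ⟨B + B', fun x y => by simp [hB x y, hB' x y], fun x => by simp [hGB, hHB]⟩

theorem exists_trilinear_eval_eq {n : ℕ} {G : MvPolynomial (Fin n) ℂ}
    (hG : G ∈ homogeneousSubmodule (Fin n) ℂ 3) :
    ∃ T : (Fin n → ℂ) →ₗ[ℂ] (Fin n → ℂ) →ₗ[ℂ] (Fin n → ℂ) →ₗ[ℂ] ℂ,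
      (∀ x y z, T x y z = T y x z) ∧ (∀ x y z, T x y z = T x z y) ∧
      ∀ x, eval x G = T x x x := by
  rw [← homogeneousSubmodule_one_pow, pow_succ, homogeneousSubmodule_one_pow] at hG
  induction hG using Submodule.mul_induction_on' with
  | mem_mul_mem G hG H hH =>
    obtain ⟨B, hB, hGB⟩ := exists_bilinear_eval_eq hG
    obtain ⟨φ, hφ⟩ := exists_linearMap_eval_eq hH
    refine ⟨(1 / 3 : ℂ) • (φ.smulRight B + (φ.smulRight B).flip +
      B.compr₂ (LinearMap.id.smulRight φ)), fun x y z => ?_, fun x y z => ?_, fun x => ?_⟩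
    · simp [hB x y]; ring
    · simp [hB y z]; ring
    · simp [hφ, hGB]; ring
  | add G _ H _ hG hH =>
    obtain ⟨T, h1, h2, hGT⟩ := hG
    obtain ⟨T', h1', h2', hHT⟩ := hH
    exact ⟨T + T', fun x y z => by simp [h1 x y z, h1' x y z],
      fun x y z => by simp [h2 x y z, h2' x y z], fun x => by simp [hGT, hHT]⟩

end Forms

/-! ### Quadratic and cubic forms vanishing on the roots -/

/-- A vector of signs with an even number of minus signs; such vectors are twice the half-integral
roots. -/
def IsEvenSign (σ : Fin 8 → ℝ) : Prop := (∀ i, σ i = 1 ∨ σ i = -1) ∧ ∏ i, σ i = 1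

/-- The sign vector with minus signs exactly at `a` and `b`. -/
def pairFlip (a b : Fin 8) : Fin 8 → ℝ := fun i => if i = a ∨ i = b then -1 else 1

theorem IsEvenSign.one : IsEvenSign 1 := ⟨fun _ => Or.inl rfl, by simp⟩

theorem IsEvenSign.mul_pairFlip {σ : Fin 8 → ℝ} (hσ : IsEvenSign σ) {a b : Fin 8} (hab : a ≠ b) :
    IsEvenSign (σ * pairFlip a b) := by
  refine ⟨fun i => ?_, ?_⟩
  · simp only [Pi.mul_apply, pairFlip]
    rcases hσ.1 i with h | h <;> rw [h] <;> split_ifs <;> simp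
  · have h : ∏ i, pairFlip a b i = 1 := by
      have : ∀ i, pairFlip a b i = (if i = a then -1 else 1) * (if i = b then -1 else 1) := by
        intro i
        by_cases h1 : i = a <;> by_cases h2 : i = b <;> simp_all [pairFlip]
      simp only [this, Finset.prod_mul_distrib, Finset.prod_ite_eq', Finset.mem_univ, if_true]
      norm_num
    simp [Finset.prod_mul_distrib, hσ.2, h]

theorem IsEvenSign.half_smul_mem_rootsC {σ : Fin 8 → ℝ} (hσ : IsEvenSign σ) :
    (1 / 2 : ℂ) • toComplex σ ∈ rootsC := by
  classical
  let S : Finset (Fin 8) := Finset.univ.filter fun i => σ i = -1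
  have hσS : ∀ i, σ i = if i ∈ S then -1 else 1 := by
    intro i
    rcases hσ.1 i with h | h
    · simp only [S, Finset.mem_filter_univ, h]; norm_num
    · simp only [S, Finset.mem_filter_univ, h]; norm_num
  have hS : Even S.card := by
    have h := hσ.2
    simp only [hσS, Finset.prod_ite_mem, Finset.univ_inter, Finset.prod_const] at h
    exact (neg_one_pow_eq_one_iff_even (by norm_num)).1 h
  refine ⟨halfVec S, halfVec_mem_roots hS, funext fun i => ?_⟩
  simp only [toComplex, halfVec, Pi.smul_apply, smul_eq_mul, hσS i]
  split_ifs <;> push_cast <;> ring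

/-- The standard basis vectors of `ℂ⁸`. -/
def basisVec (i : Fin 8) : Fin 8 → ℂ := Pi.single i 1

/-- Flipping two signs of a half-integral root subtracts a root `± e_a ± e_b`. -/
theorem half_smul_mul_pairFlip (σ : Fin 8 → ℝ) {a b : Fin 8} (hab : a ≠ b) :
    (1 / 2 : ℂ) • toComplex (σ * pairFlip a b) = (1 / 2 : ℂ) • toComplex σ -
      ((σ a : ℂ) • basisVec a + (σ b : ℂ) • basisVec b) := by
  funext i
  simp only [toComplex, pairFlip, basisVec, Pi.smul_apply, Pi.sub_apply, Pi.add_apply,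
    Pi.mul_apply, Pi.single_apply, smul_eq_mul]
  by_cases h1 : i = a
  · subst h1
    simp [hab]; ring
  · by_cases h2 : i = b
    · subst h2
      simp [h1]; ring
    · simp [h1, h2]

theorem pairFlip_left (a b : Fin 8) : pairFlip a b a = -1 := by simp [pairFlip]

theorem pairFlip_of_ne {a b i : Fin 8} (h1 : i ≠ a) (h2 : i ≠ b) : pairFlip a b i = 1 := by
  simp [pairFlip, h1, h2]

theorem basisVec_add_mem_rootsC {i j : Fin 8} (h : i ≠ j) : basisVec i + basisVec j ∈ rootsC := by
  refine ⟨_, single_add_single_mem_roots h (Or.inl rfl) (Or.inl rfl), funext fun k => ?_⟩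
  simp [toComplex, basisVec, Pi.single_apply, apply_ite (fun x : ℝ => (x : ℂ))]

theorem basisVec_sub_mem_rootsC {i j : Fin 8} (h : i ≠ j) : basisVec i - basisVec j ∈ rootsC := by
  refine ⟨_, single_add_single_mem_roots h (Or.inl rfl) (Or.inr rfl), funext fun k => ?_⟩
  simp [toComplex, basisVec, Pi.single_apply, apply_ite (fun x : ℝ => (x : ℂ)), sub_eq_add_neg,
    apply_ite (fun x : ℂ => -x)]

theorem sum_smul_basisVec (x : Fin 8 → ℂ) : ∑ i, x i • basisVec i = x := by
  funext j
  simp [basisVec, Pi.single_apply]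

theorem exists_ne_of_card_lt (s : Finset (Fin 8)) (hs : s.card < 8) : ∃ i, ∀ j ∈ s, i ≠ j := by
  obtain ⟨i, hi⟩ : ∃ i, i ∉ s := by
    by_contra! h
    have := Finset.eq_univ_iff_forall.2 h
    simp [this] at hs
  exact ⟨i, fun j hj hij => hi (hij ▸ hj)⟩

/-- If `u` has vanishing sums over all pairs of distinct indices, then it vanishes. -/
theorem eq_zero_of_add_eq_zero {u : Fin 8 → ℂ} (h : ∀ i j, i ≠ j → u i + u j = 0) (i : Fin 8) :
    u i = 0 := by
  obtain ⟨j, hj⟩ := exists_ne_of_card_lt {i} (by simp)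
  obtain ⟨k, hk⟩ := exists_ne_of_card_lt {i, j} (Finset.card_le_two.trans_lt (by norm_num))
  simp only [Finset.mem_insert, Finset.mem_singleton, forall_eq_or_imp, forall_eq] at hj hk
  have h1 := h j i hj
  have h2 := h k i hk.1
  have h3 := h k j hk.2
  linear_combination (h1 + h2 - h3) / 2

/-- No nonzero quadratic form vanishes on the roots; the roots `± eᵢ ± eⱼ` suffice. -/
theorem bilinear_apply_self_eq_zero {B : (Fin 8 → ℂ) →ₗ[ℂ] (Fin 8 → ℂ) →ₗ[ℂ] ℂ}
    (hB : ∀ x y, B x y = B y x) (h : ∀ v ∈ rootsC, B v v = 0) (x : Fin 8 → ℂ) : B x x = 0 := by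
  have hpair : ∀ i j, i ≠ j → B (basisVec i) (basisVec i) + B (basisVec j) (basisVec j) = 0 ∧
      B (basisVec i) (basisVec j) = 0 := by
    intro i j hij
    have h1 := h _ (basisVec_add_mem_rootsC hij)
    have h2 := h _ (basisVec_sub_mem_rootsC hij)
    simp only [map_add, map_sub, LinearMap.add_apply, LinearMap.sub_apply,
      hB (basisVec j) (basisVec i)] at h1 h2
    exact ⟨by linear_combination (h1 + h2) / 2, by linear_combination (h1 - h2) / 4⟩
  have hdiag := eq_zero_of_add_eq_zero fun i j hij => (hpair i j hij).1
  rw [← sum_smul_basisVec x]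
  simp only [map_sum, LinearMap.sum_apply, map_smul, LinearMap.smul_apply]
  refine Finset.sum_eq_zero fun i _ => ?_
  rw [Finset.sum_eq_zero fun j _ => ?_, smul_zero]
  by_cases hij : i = j
  · rw [hij, hdiag, smul_zero]
  · rw [(hpair _ _ (Ne.symm hij)).2, smul_zero]

section Cubic

variable {T : (Fin 8 → ℂ) →ₗ[ℂ] (Fin 8 → ℂ) →ₗ[ℂ] (Fin 8 → ℂ) →ₗ[ℂ] ℂ}

/-- The third difference of `T(v, v, v)` along `α`, `β`, `γ` is `6 T(α, β, γ)` up to sign, so this value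
vanishes if the form vanishes at the vertices of the cube. -/
theorem trilinear_eq_zero_of_vertices (h12 : ∀ x y z, T x y z = T y x z)
    (h23 : ∀ x y z, T x y z = T x z y) {x α β γ : Fin 8 → ℂ}
    (h0 : T x x x = 0) (h1 : T (x - α) (x - α) (x - α) = 0) (h2 : T (x - β) (x - β) (x - β) = 0)
    (h3 : T (x - γ) (x - γ) (x - γ) = 0)
    (h4 : T (x - α - β) (x - α - β) (x - α - β) = 0)
    (h5 : T (x - α - γ) (x - α - γ) (x - α - γ) = 0)
    (h6 : T (x - β - γ) (x - β - γ) (x - β - γ) = 0)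
    (h7 : T (x - α - β - γ) (x - α - β - γ) (x - α - β - γ) = 0) : T α β γ = 0 := by
  have e1 := h12 β α γ
  have e2 := h23 α γ β
  have e3 : T γ α β = T α β γ := by rw [h12, h23]
  have e4 : T β γ α = T α β γ := by rw [h23, h12]
  have e5 : T γ β α = T α β γ := by rw [h12, h23, h12]
  simp only [map_sub, LinearMap.sub_apply] at h1 h2 h3 h4 h5 h6 h7
  linear_combination (h0 - h1 - h2 - h3 + h4 + h5 + h6 - h7) / 6 - (e1 + e2 + e3 + e4 + e5) / 6

/-- For even signs `σ`, the half-integral roots `σ / 2` with the signs at three disjoint pairs of indices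
flipped or not are the vertices of a cube. -/
theorem trilinear_basisVec_eq_zero (h12 : ∀ x y z, T x y z = T y x z)
    (h23 : ∀ x y z, T x y z = T x z y) (h : ∀ v ∈ rootsC, T v v v = 0) {a b c : Fin 8}
    (hab : a ≠ b) (hac : a ≠ c) (hbc : b ≠ c) :
    T (basisVec a) (basisVec b) (basisVec c) = 0 := by
  obtain ⟨p, hp⟩ := exists_ne_of_card_lt {a, b, c} (Finset.card_le_three.trans_lt (by norm_num))
  obtain ⟨q, hq⟩ := exists_ne_of_card_lt {a, b, c, p} (Finset.card_le_four.trans_lt (by norm_num))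
  obtain ⟨r, hr⟩ := exists_ne_of_card_lt {a, b, c, p, q} (Finset.card_le_five.trans_lt (by norm_num))
  obtain ⟨d, hd⟩ := exists_ne_of_card_lt {a, b, c, p, q, r}
    (Finset.card_le_six.trans_lt (by norm_num))
  simp only [Finset.mem_insert, Finset.mem_singleton, forall_eq_or_imp, forall_eq] at hp hq hr hd
  obtain ⟨hpa, hpb, hpc⟩ := hp
  obtain ⟨hqa, hqb, hqc, hqp⟩ := hq
  obtain ⟨hra, hrb, hrc, hrp, hrq⟩ := hr
  obtain ⟨hda, hdb, hdc, hdp, hdq, hdr⟩ := hd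
  have hcube : ∀ σ, IsEvenSign σ → T ((σ a : ℂ) • basisVec a + (σ p : ℂ) • basisVec p)
      ((σ b : ℂ) • basisVec b + (σ q : ℂ) • basisVec q)
      ((σ c : ℂ) • basisVec c + (σ r : ℂ) • basisVec r) = 0 := by
    intro σ hσ
    have hz : ∀ τ, IsEvenSign τ → T ((1 / 2 : ℂ) • toComplex τ) ((1 / 2 : ℂ) • toComplex τ)
      ((1 / 2 : ℂ) • toComplex τ) = 0 := fun τ hτ => h _ hτ.half_smul_mem_rootsC
    have k1 := hσ.mul_pairFlip hpa.symm
    have k2 := hσ.mul_pairFlip hqb.symm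
    have k3 := hσ.mul_pairFlip hrc.symm
    have k4 := k1.mul_pairFlip hqb.symm
    have k5 := k1.mul_pairFlip hrc.symm
    have k6 := k2.mul_pairFlip hrc.symm
    have k7 := k4.mul_pairFlip hrc.symm
    have z0 := hz _ hσ
    have z1 := hz _ k1
    have z2 := hz _ k2
    have z3 := hz _ k3
    have z4 := hz _ k4
    have z5 := hz _ k5
    have z6 := hz _ k6
    have z7 := hz _ k7
    simp only [half_smul_mul_pairFlip _ hpa.symm, half_smul_mul_pairFlip _ hqb.symm,
      half_smul_mul_pairFlip _ hrc.symm, Pi.mul_apply, pairFlip_of_ne hab.symm hpb.symm,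
      pairFlip_of_ne hqa hqp, pairFlip_of_ne hac.symm hpc.symm, pairFlip_of_ne hra hrp,
      pairFlip_of_ne hbc.symm hqc.symm, pairFlip_of_ne hrb hrq, mul_one] at z1 z2 z3 z4 z5 z6 z7
    exact trilinear_eq_zero_of_vertices h12 h23 z0 z1 z2 z3 z4 z5 z6 z7
  -- Flipping the sign at `p`, compensated at the unused index `d`, isolates `e_a`; then the same
  -- at `q` and `r`.
  have hne : ∀ σ, IsEvenSign σ → ∀ i, (σ i : ℂ) ≠ 0 := by
    intro σ hσ i
    rcases hσ.1 i with e | e <;> rw [e] <;> norm_num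
  have h1 : ∀ σ, IsEvenSign σ → T (basisVec a)
      ((σ b : ℂ) • basisVec b + (σ q : ℂ) • basisVec q)
      ((σ c : ℂ) • basisVec c + (σ r : ℂ) • basisVec r) = 0 := by
    intro σ hσ
    have e1 := hcube σ hσ
    have e2 := hcube _ (hσ.mul_pairFlip hdp.symm)
    simp only [Pi.mul_apply, pairFlip_left, pairFlip_of_ne hpa.symm hda.symm,
      pairFlip_of_ne hpb.symm hdb.symm, pairFlip_of_ne hpc.symm hdc.symm,
      pairFlip_of_ne hqp hdq.symm, pairFlip_of_ne hrp hdr.symm, mul_one] at e2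
    refine (mul_eq_zero.1 (?_ : (σ a : ℂ) * _ = 0)).resolve_left (hne σ hσ a)
    simp only [map_add, map_smul, LinearMap.add_apply, LinearMap.smul_apply, smul_eq_mul] at e1 e2 ⊢
    push_cast at e1 e2
    linear_combination (e1 + e2) / 2
  have h2 : ∀ σ, IsEvenSign σ → T (basisVec a) (basisVec b)
      ((σ c : ℂ) • basisVec c + (σ r : ℂ) • basisVec r) = 0 := by
    intro σ hσ
    have e1 := h1 σ hσ
    have e2 := h1 _ (hσ.mul_pairFlip hdq.symm)
    simp only [Pi.mul_apply, pairFlip_left, pairFlip_of_ne hqb.symm hdb.symm,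
      pairFlip_of_ne hqc.symm hdc.symm, pairFlip_of_ne hrq hdr.symm, mul_one] at e2
    refine (mul_eq_zero.1 (?_ : (σ b : ℂ) * _ = 0)).resolve_left (hne σ hσ b)
    simp only [map_add, map_smul, LinearMap.add_apply, LinearMap.smul_apply, smul_eq_mul] at e1 e2 ⊢
    push_cast at e1 e2
    linear_combination (e1 + e2) / 2
  have e1 := h2 1 IsEvenSign.one
  have e2 := h2 _ (IsEvenSign.one.mul_pairFlip hdr.symm)
  simp only [Pi.mul_apply, Pi.one_apply, pairFlip_left, pairFlip_of_ne hrc.symm hdc.symm,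
    mul_one, map_add, map_smul, smul_eq_mul] at e1 e2
  push_cast at e1 e2
  linear_combination (e1 + e2) / 2

/-- No nonzero cubic form vanishes on the roots. -/
theorem trilinear_apply_self_eq_zero (h12 : ∀ x y z, T x y z = T y x z)
    (h23 : ∀ x y z, T x y z = T x z y) (h : ∀ v ∈ rootsC, T v v v = 0) (x : Fin 8 → ℂ) :
    T x x x = 0 := by
  let u : Fin 8 → ℂ := fun i => T (basisVec i) (basisVec i) (basisVec i)
  have hpair : ∀ i j, i ≠ j → T (basisVec i) (basisVec j) (basisVec j) = -u i / 3 := by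
    intro i j hij
    have e1 := h _ (basisVec_add_mem_rootsC hij)
    have e2 := h _ (basisVec_sub_mem_rootsC hij)
    have e3 := h12 (basisVec j) (basisVec i) (basisVec j)
    have e4 := h23 (basisVec j) (basisVec j) (basisVec i)
    simp only [map_add, map_sub, LinearMap.add_apply, LinearMap.sub_apply] at e1 e2
    simp only [u]
    linear_combination (e1 + e2) / 6 - 2 / 3 * e3 - e4 / 3
  -- All coefficients of the cubic form in terms of those of the cubes.
  have hT : ∀ i j k, T (basisVec i) (basisVec j) (basisVec k) =
      (if i = j then if j = k then 2 * u i else 0 else 0) - ((if i = j then u k else 0) +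
        (if j = k then u i else 0) + (if i = k then u j else 0)) / 3 := by
    intro i j k
    by_cases hij : i = j
    · subst hij
      by_cases hik : i = k
      · subst hik
        simp [u]; ring
      · rw [h23, h12, hpair k i (Ne.symm hik)]
        simp [hik]; ring
    · by_cases hjk : j = k
      · subst hjk
        rw [hpair i j hij]
        simp [hij]; ring
      · by_cases hik : i = k
        · subst hik
          rw [h12, hpair j i (Ne.symm hij)]
          simp [hij, hjk]; ring
        · rw [trilinear_basisVec_eq_zero h12 h23 h hij hik hjk]
          simp [hij, hik, hjk]
  have hform : ∀ x, T x x x = 2 * ∑ i, u i * x i ^ 3 - (∑ i, x i ^ 2) * ∑ i, u i * x i := by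
    intro x
    conv_lhs => rw [← sum_smul_basisVec x]
    simp only [map_sum, LinearMap.sum_apply, map_smul, LinearMap.smul_apply, hT, smul_eq_mul]
    simp only [mul_sub, mul_add, add_div, Finset.sum_add_distrib, Finset.sum_sub_distrib, mul_ite,
      mul_zero, Finset.sum_ite_irrel, Finset.sum_const_zero, Finset.sum_ite_eq', ite_div, zero_div,
      Finset.mem_univ, if_true]
    have a0 : ∑ i, x i * (x i * (x i * (2 * u i))) = 2 * ∑ i, u i * x i ^ 3 := by
      rw [Finset.mul_sum]
      exact Finset.sum_congr rfl fun i _ => by ring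
    have a1 : ∑ i, x i * ∑ j, x j * (x j * (u i / 3)) =
        (∑ i, u i * x i) * (∑ i, x i ^ 2) / 3 := by
      rw [Finset.sum_mul_sum]
      simp only [Finset.sum_div, Finset.mul_sum]
      exact Finset.sum_congr rfl fun i _ => Finset.sum_congr rfl fun j _ => by ring
    have a2 : ∑ i, x i * (x i * ∑ j, x j * (u j / 3)) =
        (∑ i, x i ^ 2) * (∑ i, u i * x i) / 3 := by
      rw [Finset.sum_mul_sum]
      simp only [Finset.sum_div, Finset.mul_sum]
      exact Finset.sum_congr rfl fun i _ => Finset.sum_congr rfl fun j _ => by ring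
    have a3 : ∑ i, x i * ∑ j, x j * (x i * (u j / 3)) =
        (∑ i, x i ^ 2) * (∑ i, u i * x i) / 3 := by
      rw [Finset.sum_mul_sum]
      simp only [Finset.sum_div, Finset.mul_sum]
      exact Finset.sum_congr rfl fun i _ => Finset.sum_congr rfl fun j _ => by ring
    rw [a0, a1, a2, a3]
    ring
  -- At a half-integral root, where `xᵢ² = 1/4`, the formula reduces to a linear form.
  have hlin : ∀ σ, IsEvenSign σ → ∑ i, u i * ((1 / 2 : ℂ) • toComplex σ) i = 0 := by
    intro σ hσ
    have e := hform ((1 / 2 : ℂ) • toComplex σ)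
    have hsq : ∀ i, ((1 / 2 : ℂ) • toComplex σ) i ^ 2 = 1 / 4 := by
      intro i
      simp only [Pi.smul_apply, toComplex, smul_eq_mul]
      rcases hσ.1 i with e | e <;> rw [e] <;> norm_num
    simp only [h _ hσ.half_smul_mem_rootsC, pow_succ _ 2, hsq, mul_left_comm _ (1 / 4 : ℂ),
      ← Finset.mul_sum, Finset.sum_const, Finset.card_univ, Fintype.card_fin] at e
    norm_num at e
    simp only [Pi.smul_apply, smul_eq_mul]
    linear_combination (2 / 3 : ℂ) * e
  have hu : ∀ i, u i = 0 := by
    refine eq_zero_of_add_eq_zero fun i j hij => ?_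
    have e1 := hlin 1 IsEvenSign.one
    have e2 := hlin _ (IsEvenSign.one.mul_pairFlip hij)
    rw [half_smul_mul_pairFlip _ hij] at e2
    simp only [Pi.sub_apply, mul_sub, Finset.sum_sub_distrib, e1] at e2
    simp [basisVec, Pi.single_apply, mul_add, Finset.sum_add_distrib] at e2
    linear_combination -e2
  rw [hform]
  simp [hu]

end Cubic

/-! ### The smallest degree of a nontrivial polynomial -/

/-- On the sphere the constant and linear parts of a polynomial can be raised to degree two and
three, which reduces the claim to the quadratic and cubic forms vanishing on the roots;
antipodality separates the two. -/
theorem Nm_dvd_of_totalDegree_le_three {F : MvPolynomial (Fin 8) ℂ}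
    (hF : F ∈ vanishingIdeal ℂ rootsC) (hdeg : F.totalDegree ≤ 3) : Nm ∣ F := by
  let N : MvPolynomial (Fin 8) ℂ := ∑ i, X i ^ 2
  have hN : N.IsHomogeneous 2 := IsHomogeneous.sum _ _ _ fun i _ => isHomogeneous_X_pow i 2
  have hNroot : ∀ v ∈ rootsC, eval v N = 2 := by
    intro v hv
    have h : eval v Nm = 0 := Nm_mem_vanishingIdeal v hv
    rw [eval_Nm, sub_eq_zero] at h
    simpa [N] using h
  let c : ℕ → MvPolynomial (Fin 8) ℂ := fun n => homogeneousComponent n F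
  have hc : ∀ n, (c n).IsHomogeneous n := fun n => homogeneousComponent_isHomogeneous n F
  have hsum : F = c 0 + c 1 + c 2 + c 3 := by
    have h : ∑ n ∈ Finset.range 4, c n = F := by
      conv_rhs => rw [← sum_homogeneousComponent F]
      refine (Finset.sum_subset (Finset.range_subset_range.2 (by omega)) fun n _ hn => ?_).symm
      exact homogeneousComponent_eq_zero n F (by rw [Finset.mem_range] at hn; omega)
    rw [← h]
    simp [Finset.sum_range_succ]
  have hQ2 : (c 2 + C (1 / 2) * (c 0 * N)).IsHomogeneous 2 :=
    IsHomogeneous.add (hc 2) (((hc 0).mul hN).C_mul _)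
  have hT3 : (c 3 + C (1 / 2) * (c 1 * N)).IsHomogeneous 3 :=
    IsHomogeneous.add (hc 3) (((hc 1).mul hN).C_mul _)
  obtain ⟨B, hB, hQ⟩ := exists_bilinear_eval_eq hQ2
  obtain ⟨T, h12, h23, hT⟩ := exists_trilinear_eval_eq hT3
  have hQT : ∀ v ∈ rootsC, B v v + T v v v = 0 := by
    intro v hv
    have h : eval v F = 0 := hF v hv
    rw [← hQ, ← hT, ← h, hsum]
    simp only [map_add, map_mul, eval_C, hNroot v hv]
    ring
  have hQT' : ∀ v ∈ rootsC, B v v = 0 ∧ T v v v = 0 := by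
    intro v hv
    have h1 := hQT v hv
    have h2 := hQT _ (neg_mem_rootsC hv)
    simp only [map_neg, LinearMap.neg_apply, neg_neg] at h2
    exact ⟨by linear_combination (h1 + h2) / 2, by linear_combination (h1 - h2) / 2⟩
  have e2 : c 2 + C (1 / 2) * (c 0 * N) = 0 := MvPolynomial.funext fun x => by
    rw [hQ, map_zero, bilinear_apply_self_eq_zero hB fun v hv => (hQT' v hv).1]
  have e3 : c 3 + C (1 / 2) * (c 1 * N) = 0 := MvPolynomial.funext fun x => by
    rw [hT, map_zero, trilinear_apply_self_eq_zero h12 h23 fun v hv => (hQT' v hv).2]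
  refine ⟨C (-(1 / 2)) * (c 0 + c 1), ?_⟩
  have h2 : (C (1 / 2 : ℂ) * C 2 : MvPolynomial (Fin 8) ℂ) = 1 := by
    rw [← map_mul]; norm_num
  rw [hsum, show Nm = N - C 2 from rfl, map_neg]
  linear_combination e2 + e3 - (c 0 + c 1) * h2

theorem isLeast_totalDegree_nontrivial :
    IsLeast {n : ℕ | ∃ F ∈ vanishingIdeal ℂ rootsC, ¬ Nm ∣ F ∧ F.totalDegree = n} 4 := by
  have hlow : ∀ F ∈ vanishingIdeal ℂ rootsC, ¬ Nm ∣ F → 4 ≤ F.totalDegree := by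
    intro F hF hdvd
    by_contra! h
    exact hdvd (Nm_dvd_of_totalDegree_le_three hF (by omega))
  refine ⟨?_, ?_⟩
  · obtain ⟨F, hF, hdvd, hdeg⟩ := exists_quartic_not_dvd
    exact ⟨F, hF, hdvd, hdeg.antisymm (hlow F hF hdvd)⟩
  · rintro n ⟨F, hF, hdvd, rfl⟩
    exact hlow F hF hdvd

theorem exists_generators_totalDegree_le : ∃ G : Set (MvPolynomial (Fin 8) ℂ),
    Ideal.span G = vanishingIdeal ℂ rootsC ∧ ∀ F ∈ G, F.totalDegree ≤ 4 := by
  refine ⟨{F | F ∈ vanishingIdeal ℂ rootsC ∧ F.totalDegree ≤ 4}, eq_vanishingIdeal ?_ ?_ ?_,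
    fun F hF => hF.2⟩
  · exact Ideal.subset_span ⟨Nm_mem_vanishingIdeal, totalDegree_Nm_le.trans (by norm_num)⟩
  · exact fun a ha b hab => Ideal.subset_span
      ⟨slicedZonal_mem_vanishingIdeal ha hab, totalDegree_slicedZonal_le a b⟩
  · exact Ideal.span_le.2 fun F hF => hF.1

end E8Ideal

theorem theorem3p1 :
    E8Ideal.roots.ncard = 240 ∧
    (∀ (P : Set (Fin 8 → ℝ)) (b : (Fin 8 → ℝ) → Fin 7 → (Fin 8 → ℝ)),
      E8Ideal.IsPairRepresentatives P → E8Ideal.IsSlicingChoice P b →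
        MvPolynomial.zeroLocus ℂ (Ideal.span (E8Ideal.generators P b)) = E8Ideal.rootsC ∧
        (∀ p ∈ MvPolynomial.zeroLocus ℂ (Ideal.span (E8Ideal.generators P b)),
          E8Ideal.IsSimpleZero (Ideal.span (E8Ideal.generators P b)) p) ∧
        (Ideal.span (E8Ideal.generators P b)).IsRadical ∧
        Ideal.span (E8Ideal.generators P b) = MvPolynomial.vanishingIdeal ℂ E8Ideal.rootsC) ∧
    IsLeast {n : ℕ | ∃ F ∈ MvPolynomial.vanishingIdeal ℂ E8Ideal.rootsC,
      ¬ E8Ideal.Nm ∣ F ∧ F.totalDegree = n} 4 ∧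
    (∃ G : Set (MvPolynomial (Fin 8) ℂ),
      Ideal.span G = MvPolynomial.vanishingIdeal ℂ E8Ideal.rootsC ∧
        ∀ F ∈ G, F.totalDegree ≤ 4) := by
  refine ⟨E8Ideal.ncard_roots, fun P b hP hb => ?_, E8Ideal.isLeast_totalDegree_nontrivial,
    E8Ideal.exists_generators_totalDegree_le⟩
  have hNm : E8Ideal.Nm ∈ Ideal.span (E8Ideal.generators P b) := Ideal.subset_span (Or.inl rfl)
  have hJ : ∀ a ∈ E8Ideal.roots, ∀ d, a ⬝ᵥ d = 0 →
      E8Ideal.slicedZonal a d ∈ Ideal.span (E8Ideal.generators P b) :=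
    fun a ha d had => E8Ideal.slicedZonal_mem_span_generators hP hb ha had
  have hle := E8Ideal.span_generators_le hP hb
  have hquintic := fun a ha => E8Ideal.quintic_mem (a := a) hNm hJ ha
  exact ⟨E8Ideal.zeroLocus_eq_rootsC hNm hJ hle,
    fun p hp => ⟨hp, E8Ideal.tangentSpace_eq_bot hp hquintic⟩,
    E8Ideal.isRadical_of_quintic_mem hquintic, E8Ideal.eq_vanishingIdeal hNm hJ hle⟩
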